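/- **Definitions.** Let $\{0,1\}^*$ be the set of finite binary strings and $|s|$ the length of $s$. A *prefix-free machine* is a partial recursive function $F\colon\{0,1\}^*\to\{0,1\}^*$ whose domain $\mathrm{Dom}\,F$ is prefix-free (no element is a prefix of another one). A prefix-free machine $V$ is *optimal* if for every prefix-free machine $F$ there is $d\in\mathbb{N}$ such that for every $p\in\mathrm{Dom}\,F$ there is $q\in\mathrm{Dom}\,V$ with $V(q)=F(p)$ and $|q|\le|p|+d$. Its halting probability is $\Omega_V=\sum_{p\in\mathrm{Dom}\,V}2^{-|p|}$. For a real $\alpha$, let $\alpha{\restriction}_n$ be the string of the first $n$ bits of the base-two expansion of $\alpha-\lfloor\alpha\rfloor$ with infinitely many zeros, and let $\mathrm{Pf}(\alpha)=\{\alpha{\restriction}_n\mid n\in\mathbb{N}\}$. For $A,B\subset\{0,1\}^*$ and $f\colon\mathbb{N}\to\mathbb{N}$, we say that $A$ is *reducible to $B$ in query size $f$* if there is an oracle deterministic Turing machine which, with oracle $B$, decides $A$ (it halts on every input $x\in\{0,1\}^*$ and accepts exactly the elements of $A$) and which, on every input $x$, only queries strings of length at most $f(|x|)$. An *order function* is a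 non-decreasing total recursive function $f\colon\mathbb{N}\to\mathbb{N}$ with $\lim_{n\to\infty}f(n)=\infty$. The *computation from $A$ to $B$ is unidirectional* if, for all order functions $f$ and $g$ such that $B$ is reducible to $A$ in query size $f$ and $A$ is reducible to $B$ in query size $g$, the function $n\mapsto g(f(n))-n$ from $\mathbb{N}$ to $\mathbb{Z}$ is unbounded above. **Theorem.** Let $V$ and $W$ be optimal prefix-free machines. Then the computation from $\mathrm{Pf}(\Omega_V)$ to $\mathrm{Dom}\,W$ is unidirectional, and the computation from $\mathrm{Dom}\,W$ to $\mathrm{Pf}(\Omega_V)$ is also unidirectional. -/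

import Mathlib

/-! ### Prefix-free machines and halting probabilities -/

/-- A set of binary strings is prefix-free if none of its elements is a prefix of another one. -/
def PrefixFree (S : Set (List Bool)) : Prop :=
  ∀ p ∈ S, ∀ q ∈ S, p <+: q → p = q

/-- A prefix-free machine: a partial recursive function on binary strings with prefix-free
domain. -/
def IsPrefixFreeMachine (F : List Bool →. List Bool) : Prop :=
  Partrec F ∧ PrefixFree F.Dom

/-- An optimal prefix-free machine simulates each prefix-free machine with a constant overhead in
the length of the programs. -/
def IsOptimalPrefixFreeMachine (V : List Bool →. List Bool) : Prop :=
  IsPrefixFreeMachine V ∧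
    ∀ F : List Bool →. List Bool, IsPrefixFreeMachine F →
      ∃ d : ℕ, ∀ p ∈ F.Dom, ∃ q ∈ V.Dom, V q = F p ∧ q.length ≤ p.length + d

/-- The halting probability `Ω_V = ∑_{p ∈ Dom V} 2^{-|p|}`. (The sum converges for a prefix-free
domain, by Kraft's inequality.) -/
noncomputable def haltingProb (V : List Bool →. List Bool) : ℝ :=
  ∑' p : V.Dom, (2 : ℝ)⁻¹ ^ (p : List Bool).length

/-! ### Prefixes of a real -/

/-- The first `n` bits of the base-two expansion of `α - ⌊α⌋` with infinitely many zeros. The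
`i`-th bit (counted from `0`) is `⌊(α - ⌊α⌋) * 2 ^ (i + 1)⌋ mod 2`. -/
noncomputable def realPrefix (α : ℝ) (n : ℕ) : List Bool :=
  List.ofFn fun i : Fin n => decide (Real.digits (Int.fract α) 2 i = 1)

/-- The set `Pf(α)` of all the finite prefixes of the base-two expansion of `α - ⌊α⌋`. -/
def Pf (α : ℝ) : Set (List Bool) :=
  {s | ∃ n : ℕ, s = realPrefix α n}

/-! ### Oracle deterministic Turing machines -/

/-- The tape alphabet of an oracle machine: the blank `none`, the bits `some (Sum.inl b)`, and `k`
further symbols `some (Sum.inr i)`. -/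
abbrev TapeSymbol (k : ℕ) : Type := Option (Bool ⊕ Fin k)

/-- The instructions of an oracle machine with states `Fin m` and tape alphabet `TapeSymbol k`.

* `write a q`: write `a` into the scanned cell of the work tape, go to state `q`;
* `move d q`: move the head of the work tape by one cell in the direction `d`, go to state `q`;
* `append b q`: append the bit `b` to the string on the query tape, go to state `q`;
* `query q₁ q₀`: ask the oracle whether the string on the query tape belongs to it, erase the query
  tape, and go to state `q₁` if the answer is yes, to state `q₀` if it is no;
* `halt b`: halt, accepting if `b = true` and rejecting if `b = false`. -/
inductive OracleInstr (m k : ℕ) : Type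
  | write (a : TapeSymbol k) (q : Fin m)
  | move (d : Turing.Dir) (q : Fin m)
  | append (b : Bool) (q : Fin m)
  | query (q₁ q₀ : Fin m)
  | halt (b : Bool)

/-- An oracle deterministic Turing machine, with finitely many states, a two-way infinite work tape
over a finite alphabet, and a write-only query tape. -/
structure OracleTM : Type where
  /-- the number of states -/
  numStates : ℕ
  /-- the number of tape symbols other than the blank and the two bits -/
  numSymbols : ℕ
  /-- the initial state -/
  start : Fin numStates
  /-- the transition table: the instruction executed in a state when scanning a symbol -/
  table : Fin numStates → TapeSymbol numSymbols → OracleInstr numStates numSymbols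

namespace OracleTM

/-- A configuration: the state, the work tape (with the head position), the query string. -/
structure Cfg (M : OracleTM) : Type where
  /-- the current state -/
  state : Fin M.numStates
  /-- the work tape -/
  tape : Turing.Tape (TapeSymbol M.numSymbols)
  /-- the string on the query tape -/
  queryTape : List Bool

/-- The initial configuration on input `x`: the head scans the first symbol of `x` on an otherwise
blank work tape, and the query tape is empty. -/
def init (M : OracleTM) (x : List Bool) : M.Cfg where
  state := M.start
  tape := Turing.Tape.mk₁ (x.map fun b => some (Sum.inl b))
  queryTape := []

/-- The instruction to be executed in a configuration. -/
def instr (M : OracleTM) (c : M.Cfg) : OracleInstr M.numStates M.numSymbols :=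
  M.table c.state c.tape.head

open Classical in
/-- One step of the computation with oracle `B`; it is `none` if the machine has halted. -/
noncomputable def step (M : OracleTM) (B : Set (List Bool)) (c : M.Cfg) : Option M.Cfg :=
  match M.instr c with
  | .write a q => some ⟨q, c.tape.write a, c.queryTape⟩
  | .move d q => some ⟨q, c.tape.move d, c.queryTape⟩
  | .append b q => some ⟨q, c.tape, c.queryTape ++ [b]⟩
  | .query q₁ q₀ => some ⟨if c.queryTape ∈ B then q₁ else q₀, c.tape, []⟩
  | .halt _ => none

/-- With oracle `B`, the configuration `c` occurs in the computation on input `x`. -/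
def Visits (M : OracleTM) (B : Set (List Bool)) (x : List Bool) (c : M.Cfg) : Prop :=
  StateTransition.Reaches (M.step B) (M.init x) c

/-- With oracle `B`, the machine halts on input `x` with answer `b`. -/
def Answers (M : OracleTM) (B : Set (List Bool)) (x : List Bool) (b : Bool) : Prop :=
  ∃ c : M.Cfg, M.Visits B x c ∧ M.instr c = .halt b

/-- With oracle `B`, the machine queries the string `s` in its computation on input `x`. -/
def Queries (M : OracleTM) (B : Set (List Bool)) (x s : List Bool) : Prop :=
  ∃ c : M.Cfg, M.Visits B x c ∧ (∃ q₁ q₀, M.instr c = .query q₁ q₀) ∧ c.queryTape = s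

/-- `A` is Turing reducible to `B` via `M`: with oracle `B`, the machine `M` halts on every input,
accepting the elements of `A` and rejecting all other strings. -/
def TuringReducesVia (M : OracleTM) (A B : Set (List Bool)) : Prop :=
  ∀ x : List Bool, (x ∈ A → M.Answers B x true) ∧ (x ∉ A → M.Answers B x false)

end OracleTM

/-! ### Reducibility in query size `f` and unidirectionality -/

/-- `A` is reducible to `B` in query size `f`: some oracle deterministic Turing machine reduces `A`
to `B` and, on every input `x`, only queries strings of length at most `f |x|`. -/
def ReducibleInQuerySize (A B : Set (List Bool)) (f : ℕ → ℕ) : Prop :=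
  ∃ M : OracleTM, M.TuringReducesVia A B ∧
    ∀ x s : List Bool, M.Queries B x s → s.length ≤ f x.length

/-- An order function: a non-decreasing total recursive function tending to infinity. -/
def IsOrderFunction (f : ℕ → ℕ) : Prop :=
  Monotone f ∧ Computable f ∧ Filter.Tendsto f Filter.atTop Filter.atTop

/-- The computation from `A` to `B` is unidirectional: whenever `B` is reducible to `A` in query
size `f` and `A` is reducible to `B` in query size `g`, for order functions `f` and `g`, the
integer-valued function `g (f n) - n` is unbounded above. -/
def IsUnidirectional (A B : Set (List Bool)) : Prop :=
  ∀ f g : ℕ → ℕ, IsOrderFunction f → IsOrderFunction g →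
    ReducibleInQuerySize B A f → ReducibleInQuerySize A B g →
      ¬ BddAbove (Set.range fun n : ℕ => (g (f n) : ℤ) - (n : ℤ))

open Nat.Partrec (Code)
open Encodable (encode decode)

/-! Two bounds carry the theorem. (A) `exists_le_add_of_dom_reducible_Pf`: if `Dom W` reduces to `Pf
α`, for any real `α`, in query size `f`, then `n ≤ f n + c`. (B) `not_Pf_haltingProb_reducible`: `Pf
Ω_V` does not reduce to `Dom W` in query size `n + e`. If `g (f n) - n` were bounded above, (A)
would force the reduction of `Pf Ω_V` to `Dom W` to have query size `n + O(1)`, against (B).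

Both rest on `IsOptimalPrefixFreeMachine.exists_le_of_completeness`: if `ℓ n` bits suffice to find a
stage at which all halting programs of length at most `k n` have halted, then `k n ≤ ℓ n + n +
O(1)`; otherwise an output not yet produced at that stage would have too short a program. For (A),
the bits are the first `f n` bits of `α`, which answer all queries made on inputs of length at most
`n`. For (B), the candidates for the first `N` bits of `Ω_V` are enumerated by running the reduction
on finite stages of `Dom W`. Up to length `n`, a candidate is determined by the number of programs
of length at most `n + e` halted at its stage. By Kraft's inequality that number is `o(2 ^ n)` along
suitable `n`, so there are at most `2 ^ (N - K)` candidates with `K` arbitrarily large. Their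
number, written in `N - K` bits, reveals when `Ω_V` itself has been enumerated, hence which programs
shorter than `N` halt. -/

theorem Primrec.of_forall_finite {ι α β : Type*} [Primcodable ι] [Finite ι] [Primcodable α]
    [Primcodable β] {f : ι → α → β} (hf : ∀ i, Primrec (f i)) : Primrec₂ f := by
  obtain ⟨n, ⟨e⟩⟩ := Finite.exists_equiv_fin ι
  have h : Primrec₂ fun (j : Fin n) a => f (e.symm j) a :=
    Primrec.fin_curry₁.2 fun j => hf (e.symm j)
  exact (h.comp ((Primrec.dom_finite e).comp Primrec.fst) Primrec.snd).of_eq fun p => by simp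

/-! ### Effective simulation of oracle machines -/

/-- Effective configurations: state, work tape (left part, scanned symbol, right part), query. -/
abbrev EffCfg (m k : ℕ) : Type :=
  Fin m × (List (TapeSymbol k) × TapeSymbol k × List (TapeSymbol k)) × List Bool

namespace OracleInstr

variable {m k : ℕ}

/-- The effect of an instruction on an effective configuration; `halt` has no effect. -/
def apply (O : List Bool → Bool) (c : EffCfg m k) : OracleInstr m k → EffCfg m k
  | .write a q => (q, (c.2.1.1, a, c.2.1.2.2), c.2.2)
  | .move .left q => (q, (c.2.1.1.tail, c.2.1.1.headI, c.2.1.2.1 :: c.2.1.2.2), c.2.2)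
  | .move .right q => (q, (c.2.1.2.1 :: c.2.1.1, c.2.1.2.2.headI, c.2.1.2.2.tail), c.2.2)
  | .append b q => (q, c.2.1, c.2.2 ++ [b])
  | .query q₁ q₀ => (if O c.2.2 then q₁ else q₀, c.2.1, [])
  | .halt _ => c

/-- The answer given by a halting instruction. -/
def answer : OracleInstr m k → Option Bool
  | .halt b => some b
  | _ => none

theorem primrec_apply {σ : Type*} [Primcodable σ] {O : σ → List Bool → Bool} (hO : Primrec₂ O)
    (I : OracleInstr m k) : Primrec fun p : σ × EffCfg m k => I.apply (O p.1) p.2 := by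
  have hst : Primrec fun p : σ × EffCfg m k => p.2.1 := Primrec.fst.comp .snd
  have htape : Primrec fun p : σ × EffCfg m k => p.2.2.1 :=
    Primrec.fst.comp (Primrec.snd.comp .snd)
  have hq : Primrec fun p : σ × EffCfg m k => p.2.2.2 := Primrec.snd.comp (Primrec.snd.comp .snd)
  have hl := Primrec.fst.comp htape
  have ha := Primrec.fst.comp (Primrec.snd.comp htape)
  have hr := Primrec.snd.comp (Primrec.snd.comp htape)
  cases I with
  | write a q => exact (Primrec.const q).pair ((hl.pair ((Primrec.const a).pair hr)).pair hq)
  | move d q =>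
    cases d with
    | left =>
      exact (Primrec.const q).pair (((Primrec.list_tail.comp hl).pair
        ((Primrec.list_headI.comp hl).pair (Primrec.list_cons.comp ha hr))).pair hq)
    | right =>
      exact (Primrec.const q).pair (((Primrec.list_cons.comp ha hl).pair
        ((Primrec.list_headI.comp hr).pair (Primrec.list_tail.comp hr))).pair hq)
  | append b q =>
    exact (Primrec.const q).pair (htape.pair (Primrec.list_concat.comp hq (Primrec.const b)))
  | query q₁ q₀ =>
    have hc : Primrec fun p : σ × EffCfg m k => cond (O p.1 p.2.2.2) q₁ q₀ :=
      Primrec.cond (hO.comp .fst hq) (.const q₁) (.const q₀)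
    exact (hc.pair (htape.pair (.const []))).of_eq fun p => by
      cases h : O p.1 p.2.2.2 <;> simp [apply, h]
  | halt b => exact Primrec.snd

end OracleInstr

namespace OracleTM

variable (M : OracleTM)

/-- The instruction to be executed in an effective configuration. -/
def effInstr (c : EffCfg M.numStates M.numSymbols) : OracleInstr M.numStates M.numSymbols :=
  M.table c.1 c.2.1.2.1

/-- One step of the computation on effective configurations. -/
def effStep (O : List Bool → Bool) (c : EffCfg M.numStates M.numSymbols) :
    EffCfg M.numStates M.numSymbols :=
  (M.effInstr c).apply O c

/-- The initial effective configuration. -/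
def effInit (x : List Bool) : EffCfg M.numStates M.numSymbols :=
  (M.start, ([], (x.map fun b => some (Sum.inl b)).headI,
    (x.map fun b => some (Sum.inl b)).tail), [])

/-- The answer of `M` with oracle `O` on input `x` within `t` steps. -/
def run (O : List Bool → Bool) (x : List Bool) (t : ℕ) : Option Bool :=
  (M.effInstr ((M.effStep O)^[t] (M.effInit x))).answer

theorem primrec_run {σ : Type*} [Primcodable σ] {O : σ → List Bool → Bool} (hO : Primrec₂ O)
    {α : Type*} [Primcodable α] {s : α → σ} {x : α → List Bool} {t : α → ℕ} (hs : Primrec s)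
    (hx : Primrec x) (ht : Primrec t) : Primrec fun a => M.run (O (s a)) (x a) (t a) := by
  have hhead : Primrec fun c : EffCfg M.numStates M.numSymbols => (c.1, c.2.1.2.1) :=
    Primrec.fst.pair (Primrec.fst.comp (Primrec.snd.comp (Primrec.fst.comp Primrec.snd)))
  have hstep : Primrec₂ fun (a : α) c => M.effStep (O (s a)) c := by
    have h : Primrec₂ fun (i : Fin M.numStates × TapeSymbol M.numSymbols)
        (p : σ × EffCfg M.numStates M.numSymbols) => (M.table i.1 i.2).apply (O p.1) p.2 :=
      Primrec.of_forall_finite fun i => OracleInstr.primrec_apply hO _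
    exact (h.comp (hhead.comp Primrec.snd) ((hs.comp Primrec.fst).pair Primrec.snd)).to₂
  have hmap : Primrec fun a => (x a).map fun b => (some (Sum.inl b) : TapeSymbol M.numSymbols) :=
    Primrec.list_map hx (Primrec.option_some.comp (Primrec.sumInl.comp Primrec.snd)).to₂
  have hinit : Primrec fun a => M.effInit (x a) :=
    (Primrec.const M.start).pair (((Primrec.const []).pair
      ((Primrec.list_headI.comp hmap).pair (Primrec.list_tail.comp hmap))).pair (.const []))
  have hans : Primrec fun c => (M.effInstr c).answer :=
    (Primrec.dom_finite fun i : Fin M.numStates × TapeSymbol M.numSymbols =>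
      (M.table i.1 i.2).answer).comp hhead
  exact hans.comp (Primrec.nat_iterate ht hinit hstep)

variable {M}

theorem run_eq_some_of_le {O : List Bool → Bool} {x : List Bool} {t t' : ℕ} {b : Bool}
    (h : M.run O x t = some b) (htt' : t ≤ t') : M.run O x t' = some b := by
  induction t', htt' using Nat.le_induction with
  | base => exact h
  | succ n _ ih =>
    rw [run] at ih ⊢
    rw [Function.iterate_succ_apply']
    set c := (M.effStep O)^[n] (M.effInit x)
    have : M.effStep O c = c := by
      rw [effStep]
      cases hI : M.effInstr c <;> simp_all [OracleInstr.answer, OracleInstr.apply]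
    rwa [this]

theorem run_unique {O : List Bool → Bool} {x : List Bool} {t t' : ℕ} {b b' : Bool}
    (h : M.run O x t = some b) (h' : M.run O x t' = some b') : b = b' := by
  have h₁ := run_eq_some_of_le h (le_max_left t t')
  have h₂ := run_eq_some_of_le h' (le_max_right t t')
  exact Option.some.inj (h₁.symm.trans h₂)

/-- The configuration represented by an effective configuration. -/
def ofEff (c : EffCfg M.numStates M.numSymbols) : M.Cfg :=
  ⟨c.1, ⟨c.2.1.2.1, Turing.ListBlank.mk c.2.1.1, Turing.ListBlank.mk c.2.1.2.2⟩, c.2.2⟩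

theorem ofEff_effInit (x : List Bool) : ofEff (M.effInit x) = M.init x := by
  simp [ofEff, effInit, init, Turing.Tape.mk₁, Turing.Tape.mk₂, Turing.Tape.mk']

theorem instr_ofEff (c : EffCfg M.numStates M.numSymbols) : M.instr (ofEff c) = M.effInstr c :=
  rfl

theorem step_ofEff {B : Set (List Bool)} {O : List Bool → Bool}
    {c : EffCfg M.numStates M.numSymbols} (hc : (M.effInstr c).answer = none)
    (hO : (∃ q₁ q₀, M.effInstr c = .query q₁ q₀) → (O c.2.2 = true ↔ c.2.2 ∈ B)) :
    M.step B (ofEff c) = some (ofEff (M.effStep O c)) := by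
  rw [step, instr_ofEff, effStep]
  cases hI : M.effInstr c with
  | write a q => rfl
  | move d q =>
    -- The empty list stands for a blank half-tape: `headI` of `[]` is the default `none`, the
    -- blank.
    cases d <;> simp [OracleInstr.apply, ofEff, Turing.Tape.move]
  | append b q => rfl
  | query q₁ q₀ =>
    have := hO ⟨_, _, hI⟩
    by_cases hB : c.2.2 ∈ B <;> simp [OracleInstr.apply, ofEff, this, hB]
  | halt b => simp [hI, OracleInstr.answer] at hc

/-- Both computations agree step by step as long as `O` is correct on the strings actually queried.
A bound on the query size thus lets a finite part of `B` replace it. -/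
theorem eventually_run_eq_some {B : Set (List Bool)} {O : List Bool → Bool} {x : List Bool}
    {b : Bool} (h : M.Answers B x b) (hO : ∀ s, M.Queries B x s → (O s = true ↔ s ∈ B)) :
    ∃ T, ∀ t ≥ T, M.run O x t = some b := by
  obtain ⟨c, hc, hb⟩ := h
  suffices ∃ T, ofEff ((M.effStep O)^[T] (M.effInit x)) = c by
    obtain ⟨T, rfl⟩ := this
    refine ⟨T, fun t ht => run_eq_some_of_le ?_ ht⟩
    rw [instr_ofEff] at hb
    rw [run, hb, OracleInstr.answer]
  clear hb
  induction hc with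
  | refl => exact ⟨0, ofEff_effInit x⟩
  | @tail c c' hr hs ih =>
    obtain ⟨T, rfl⟩ := ih
    refine ⟨T + 1, ?_⟩
    rw [Function.iterate_succ_apply']
    set e := (M.effStep O)^[T] (M.effInit x)
    have hna : (M.effInstr e).answer = none := by
      cases hI : M.effInstr e with
      | halt b' => simp [step, instr_ofEff, hI] at hs
      | _ => rfl
    rw [step_ofEff (O := O) hna] at hs
    · exact Option.some.inj hs
    · exact fun hq => hO e.2.2 ⟨_, hr, hq, rfl⟩

end OracleTM

/-! ### Enumerating strings -/

/-- The list of all strings of length `n`. -/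
def stringsOfLength : ℕ → List (List Bool)
  | 0 => [[]]
  | n + 1 => (stringsOfLength n).map (List.cons false) ++ (stringsOfLength n).map (List.cons true)

/-- The list of all strings of length at most `n`. -/
def stringsUpTo (n : ℕ) : List (List Bool) :=
  (List.range (n + 1)).flatMap stringsOfLength

theorem mem_stringsOfLength {n : ℕ} {s : List Bool} : s ∈ stringsOfLength n ↔ s.length = n := by
  induction n generalizing s with
  | zero => simp [stringsOfLength]
  | succ n ih => rcases s with _ | ⟨_ | _, s⟩ <;> simp [stringsOfLength, ih]

theorem nodup_stringsOfLength (n : ℕ) : (stringsOfLength n).Nodup := by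
  induction n with
  | zero => simp [stringsOfLength]
  | succ n ih =>
    refine List.Nodup.append (ih.map List.cons_injective) (ih.map List.cons_injective) ?_
    intro s h₁ h₂
    simp only [List.mem_map] at h₁ h₂
    obtain ⟨_, _, rfl⟩ := h₁
    obtain ⟨_, _, h⟩ := h₂
    simp at h

theorem mem_stringsUpTo {n : ℕ} {s : List Bool} : s ∈ stringsUpTo n ↔ s.length ≤ n := by
  simp [stringsUpTo, mem_stringsOfLength]

theorem primrec_stringsOfLength : Primrec stringsOfLength := by
  have hc (b : Bool) : Primrec₂ fun (_ : ℕ × List (List Bool)) (s : List Bool) => b :: s :=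
    (Primrec.list_cons.comp (Primrec.const b) Primrec.snd).to₂
  have h : Primrec₂ fun (_ : ℕ) (l : List (List Bool)) =>
      l.map (List.cons false) ++ l.map (List.cons true) :=
    Primrec.list_append.comp (Primrec.list_map .snd (hc false)) (Primrec.list_map .snd (hc true))
  refine (Primrec.nat_rec₁ [[]] h).of_eq fun n => ?_
  induction n with
  | zero => rfl
  | succ n ih => rw [stringsOfLength, ← ih]

theorem primrec_stringsUpTo : Primrec stringsUpTo :=
  Primrec.list_flatMap (Primrec.list_range.comp Primrec.succ)
    (primrec_stringsOfLength.comp Primrec.snd).to₂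

theorem primrecPred_prefix : PrimrecRel fun s u : List Bool => s <+: u :=
  (Primrec.eq.comp (f := fun p : List Bool × List Bool => p.1) .fst
    (Primrec.list_take.comp (Primrec.list_length.comp .fst) .snd)).of_eq fun _ =>
      List.prefix_iff_eq_take.symm

/-! ### Step-bounded evaluation of machines -/

/-- `c` is a code of the partial recursive function `V`. -/
def IsCodeOf (c : Code) (V : List Bool →. List Bool) : Prop :=
  c.eval = fun n => (Part.ofOption (decode n)).bind fun p => (V p).map encode

/-- The program `p` halts within stage `t`. -/
def haltsIn (c : Code) (t : ℕ) (p : List Bool) : Bool :=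
  (c.evaln t (encode p)).isSome

theorem Partrec.exists_isCodeOf {V : List Bool →. List Bool} (hV : Partrec V) :
    ∃ c, IsCodeOf c V :=
  Code.exists_code.1 hV

theorem haltsIn_mono {c : Code} {t t' : ℕ} {p : List Bool} (h : t ≤ t') (hp : haltsIn c t p) :
    haltsIn c t' p := by
  obtain ⟨y, hy⟩ := Option.isSome_iff_exists.1 hp
  exact Option.isSome_iff_exists.2 ⟨y, Code.evaln_mono h hy⟩

namespace IsCodeOf

variable {c : Code} {V : List Bool →. List Bool}

theorem eval_encode (hc : IsCodeOf c V) (p : List Bool) :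
    c.eval (encode p) = (V p).map encode := by
  rw [hc]; simp

theorem mem_dom_of_haltsIn (hc : IsCodeOf c V) {t : ℕ} {p : List Bool} (h : haltsIn c t p) :
    p ∈ V.Dom := by
  obtain ⟨y, hy⟩ := Option.isSome_iff_exists.1 h
  have := Code.evaln_sound hy
  rw [hc.eval_encode] at this
  exact this.1

theorem exists_haltsIn (hc : IsCodeOf c V) {p : List Bool} (hp : p ∈ V.Dom) :
    ∃ T, ∀ t ≥ T, haltsIn c t p := by
  have : encode ((V p).get hp) ∈ c.eval (encode p) := by
    rw [hc.eval_encode]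
    exact Part.mem_map _ (Part.get_mem hp)
  obtain ⟨T, hT⟩ := Code.evaln_complete.1 this
  exact ⟨T, fun t ht => haltsIn_mono ht (Option.isSome_iff_exists.2 ⟨_, hT⟩)⟩

end IsCodeOf

theorem primrec_haltsIn (c : Code) : Primrec₂ (haltsIn c) :=
  (Primrec.option_isSome.comp (Code.primrec_evaln.comp
    ((Primrec.fst.pair (.const c)).pair (Primrec.encode.comp .snd)))).to₂

/-- A string longer than all the outputs that are produced within stage `t`. -/
def freshString (c : Code) (t : ℕ) : List Bool :=
  true :: (List.range t).flatMap fun i =>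
    ((c.evaln t i).bind (decode (α := List Bool))).getD []

theorem primrec_freshString (c : Code) : Primrec (freshString c) := by
  have h : Primrec₂ fun t i => ((c.evaln t i).bind (decode (α := List Bool))).getD [] :=
    Primrec.option_getD.comp (Primrec.option_bind (Code.primrec_evaln.comp
      ((Primrec.fst.pair (.const c)).pair .snd)) (Primrec.decode.comp .snd).to₂) (.const [])
  exact Primrec.list_cons.comp (.const true) (Primrec.list_flatMap Primrec.list_range h)

/-- By `Code.evaln_bound` a program halted within stage `t` has code below `t`, so its output is a
block of the concatenation, and the leading `true` makes the fresh string strictly longer. -/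
theorem freshString_notMem {c : Code} {V : List Bool →. List Bool} (hc : IsCodeOf c V) {t : ℕ}
    {p : List Bool} (hp : haltsIn c t p) : freshString c t ∉ V p := by
  intro h
  obtain ⟨y, hy⟩ := Option.isSome_iff_exists.1 hp
  have hmem := Code.evaln_sound hy
  rw [hc.eval_encode] at hmem
  obtain ⟨z, hz, rfl⟩ := (Part.mem_map_iff _).1 hmem
  obtain rfl := Part.mem_unique h hz
  have hlt := Code.evaln_bound hy
  have hsub : (freshString c t).Sublist ((List.range t).flatMap fun i =>
      ((c.evaln t i).bind (decode (α := List Bool))).getD []) := by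
    have := List.sublist_flatten_of_mem (L := (List.range t).map fun i =>
      ((c.evaln t i).bind (decode (α := List Bool))).getD [])
      (l := freshString c t) (List.mem_map.2 ⟨_, List.mem_range.2 hlt, by
        rw [hy]; simp⟩)
    rwa [← List.flatMap_def] at this
  have := hsub.length_le
  conv_lhs at this => rw [freshString]
  simp at this

/-! ### The diagonal argument -/

/-- Consider the machine that, on `0^n 1 s` with `|s| = ℓ n`, searches for a stage `t` accepted by
`R n s` and outputs `freshString c t`. By optimality `V` has a program for this output of length at
most `ℓ n + n + O(1)`; it cannot have halted by stage `t`, so it is longer than `k n`. The unary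
code of `n` costs the summand `n`. -/
theorem IsOptimalPrefixFreeMachine.exists_le_of_completeness {V : List Bool →. List Bool}
    (hV : IsOptimalPrefixFreeMachine V) {c : Code} (hc : IsCodeOf c V)
    {R : ℕ → List Bool → ℕ → Bool}
    (hR : Computable fun p : (ℕ × List Bool) × ℕ => R p.1.1 p.1.2 p.2)
    {ℓ k : ℕ → ℕ} (hℓ : Computable ℓ)
    (h : ∀ n, ∃ s : List Bool, s.length = ℓ n ∧ (∃ t, R n s t) ∧
      ∀ t, R n s t → ∀ q ∈ V.Dom, q.length ≤ k n → haltsIn c t q) :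
    ∃ d, ∀ n, k n ≤ ℓ n + n + d := by
  let good (p : List Bool) : Prop := p.length = p.idxOf true + 1 + ℓ (p.idxOf true)
  have hidx : Computable fun p : List Bool => p.idxOf true :=
    (Primrec.list_idxOf.comp (.const true) .id).to_comp
  let G (p : List Bool) (t : ℕ) : Option (List Bool) :=
    bif decide (p.length = p.idxOf true + 1 + ℓ (p.idxOf true)) &&
        R (p.idxOf true) (p.drop (p.idxOf true + 1)) t
    then some (freshString c t) else none
  have hG : Computable₂ G := by
    have hi : Computable fun x : List Bool × ℕ => x.1.idxOf true := hidx.comp .fst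
    have hi' := Computable.succ.comp hi
    have h₁ : Computable fun x : List Bool × ℕ =>
        decide (x.1.length = x.1.idxOf true + 1 + ℓ (x.1.idxOf true)) :=
      (Primrec.eq.decide.to_comp).comp (Computable.list_length.comp .fst)
        (Primrec.nat_add.to_comp.comp hi' (hℓ.comp hi))
    have h₂ : Computable fun x : List Bool × ℕ =>
        R (x.1.idxOf true) (x.1.drop (x.1.idxOf true + 1)) x.2 :=
      hR.comp ((hi.pair (Primrec.list_drop.to_comp.comp hi' .fst)).pair .snd)
    exact Computable.cond (Primrec.and.to_comp.comp h₁ h₂)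
      (Computable.option_some.comp ((primrec_freshString c).to_comp.comp .snd)) (.const none)
  have hF : IsPrefixFreeMachine fun p => Nat.rfindOpt (G p) := by
    refine ⟨Partrec.rfindOpt hG, fun p hp q hq hpq => ?_⟩
    have hlen (p : List Bool) (hp : p ∈ PFun.Dom fun p => Nat.rfindOpt (G p)) :
        p.length = p.idxOf true + 1 + ℓ (p.idxOf true) := by
      obtain ⟨t, y, hy⟩ := Nat.rfindOpt_dom.1 hp
      by_contra hne
      simp [G, hne] at hy
    have hp := hlen p hp
    have hq := hlen q hq
    obtain ⟨r, rfl⟩ := hpq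
    -- On a string without `true`, `idxOf` returns the length, which the length condition excludes.
    have hmem : true ∈ p := List.idxOf_lt_length_iff.1 (by omega)
    rw [List.idxOf_append_of_mem hmem] at hq
    have : r = [] := List.eq_nil_of_length_eq_zero (by rw [List.length_append] at hq; omega)
    simp [this]
  obtain ⟨d, hd⟩ := hV.2 _ hF
  refine ⟨1 + d, fun n => ?_⟩
  obtain ⟨s, hs, ⟨t, ht⟩, hcomp⟩ := h n
  let p := List.replicate n false ++ true :: s
  have hip : p.idxOf true = n := by simp [p, List.idxOf_append]
  have hdrop : p.drop (n + 1) = s := by simp [p, List.drop_append]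
  have hpl : p.length = n + 1 + ℓ n := by simp [p, hs]; ring
  have hGp (t : ℕ) : G p t = bif R n s t then some (freshString c t) else none := by
    simp only [G, hip, hdrop, hpl, decide_true, Bool.true_and]
  have hdom : (Nat.rfindOpt (G p)).Dom := by
    refine Nat.rfindOpt_dom.2 ⟨t, freshString c t, ?_⟩
    rw [hGp, ht]; simp
  obtain ⟨q, hq, hqV, hql⟩ := hd p hdom
  by_contra hlt
  push Not at hlt
  -- The search may stop at a stage other than `t`, which is why completeness is required of every
  -- accepted stage.
  obtain ⟨t', ht'⟩ := Nat.rfindOpt_spec (Part.get_mem hdom)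
  rw [hGp] at ht'
  cases hRt : R n s t' with
  | false => simp [hRt] at ht'
  | true =>
    simp only [hRt, cond_true, Option.mem_def, Option.some.injEq] at ht'
    refine freshString_notMem hc (hcomp t' hRt q hq (by omega)) ?_
    rw [hqV, ht']
    exact Part.get_mem hdom

/-! ### Prefixes of a real -/

theorem length_realPrefix (α : ℝ) (n : ℕ) : (realPrefix α n).length = n := by
  simp [realPrefix]

theorem realPrefix_prefix {m n : ℕ} (α : ℝ) (h : m ≤ n) : realPrefix α m <+: realPrefix α n := by
  rw [List.prefix_iff_eq_take, length_realPrefix]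
  refine List.ext_getElem (by simp [length_realPrefix, h]) fun i _ _ => ?_
  simp [realPrefix]

theorem mem_Pf_iff_prefix {α : ℝ} {s : List Bool} {n : ℕ} (h : s.length ≤ n) :
    s ∈ Pf α ↔ s <+: realPrefix α n := by
  constructor
  · rintro ⟨m, rfl⟩
    exact realPrefix_prefix α (by rwa [length_realPrefix] at h)
  · intro hs
    refine ⟨s.length, ?_⟩
    have h₁ := List.prefix_iff_eq_take.1 hs
    have h₂ := List.prefix_iff_eq_take.1 (realPrefix_prefix α h)
    rw [length_realPrefix] at h₂
    rw [h₂, ← h₁]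

/-! ### Reducing the halting problem to a real -/

theorem Computable.natFind {p : ℕ → ℕ → Prop} [∀ n, DecidablePred (p n)]
    (hp : Computable₂ fun n m => decide (p n m)) (h : ∀ n, ∃ m, p n m) :
    Computable fun n => Nat.find (h n) := by
  refine Partrec.of_eq (Partrec.rfind (p := fun n => (fun m => decide (p n m) : ℕ →. Bool))
    hp.partrec₂) fun n => ?_
  refine Part.eq_some_iff.2 (Nat.mem_rfind.2 ⟨?_, fun {m} hm => ?_⟩)
  · simpa using Nat.find_spec (h n)
  · simpa using Nat.find_min (h n) hm

theorem List.exists_forall_ge {α : Type*} (l : List α) {P : α → ℕ → Prop}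
    (h : ∀ a ∈ l, ∃ T, ∀ t ≥ T, P a t) : ∃ T, ∀ t ≥ T, ∀ a ∈ l, P a t := by
  have : ∀ᶠ t in Filter.atTop, ∀ a ∈ {a | a ∈ l}, P a t :=
    (Filter.eventually_all_finite l.finite_toSet).2 fun a ha => Filter.eventually_atTop.2 (h a ha)
  exact Filter.eventually_atTop.1 this

theorem exists_le_add_of_dom_reducible_Pf {W : List Bool →. List Bool}
    (hW : IsOptimalPrefixFreeMachine W) {α : ℝ} {f : ℕ → ℕ} (hmono : Monotone f)
    (hf : Computable f) (hred : ReducibleInQuerySize W.Dom (Pf α) f) :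
    ∃ c, ∀ n, n ≤ f n + c := by
  by_contra! hlt
  obtain ⟨M, hM, hsize⟩ := hred
  obtain ⟨c, hc⟩ := Partrec.exists_isCodeOf hW.1.1
  -- A gap of `2 * e` exceeds the cost `e` of coding the index in unary by an unbounded amount.
  have hlt₂ (e : ℕ) : ∃ n, f n + 2 * e < n := hlt (2 * e)
  let ν (e : ℕ) : ℕ := Nat.find (hlt₂ e)
  have hνlt (e : ℕ) : f (ν e) + 2 * e < ν e := Nat.find_spec (hlt₂ e)
  have hν : Computable ν := by
    refine Computable.natFind (p := fun e n => f n + 2 * e < n) ?_ hlt₂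
    exact Primrec.nat_lt.decide.to_comp.comp
      (Primrec.nat_add.to_comp.comp (hf.comp .snd) (Primrec.nat_double.to_comp.comp .fst)) .snd
  let O (s q : List Bool) : Bool := decide (q <+: s)
  have hO : Primrec₂ O := primrecPred_prefix.decide.swap
  let P (p : (ℕ × List Bool) × ℕ) (x : List Bool) : Prop :=
    M.run (O p.1.2) x p.2 = some (haltsIn c p.2 x)
  have hP : PrimrecRel P := by
    refine Primrec.eq.comp (M.primrec_run hO (Primrec.snd.comp (Primrec.fst.comp .fst)) .snd
      (Primrec.snd.comp .fst)) (Primrec.option_some.comp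
        ((primrec_haltsIn c).comp (Primrec.snd.comp .fst) .snd))
  -- A stage is accepted once the answers of `M`, with the prefixes of the certificate as oracle,
  -- coincide with what has halted so far.
  let Q (p : (ℕ × List Bool) × ℕ) : Prop := ∀ x ∈ stringsUpTo p.1.1, P p x
  have hQ : PrimrecPred Q :=
    (hP.swap.forall_mem_list.comp (primrec_stringsUpTo.comp (Primrec.fst.comp .fst)) .id)
  have : DecidablePred Q := fun p => inferInstanceAs (Decidable (∀ x ∈ stringsUpTo p.1.1, P p x))
  have hrun (n : ℕ) (x : List Bool) (hx : x.length ≤ n) (b : Bool)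
      (hb : M.Answers (Pf α) x b) :
      ∃ T, ∀ t ≥ T, M.run (O (realPrefix α (f n))) x t = some b := by
    refine OracleTM.eventually_run_eq_some hb fun s hs => ?_
    rw [decide_eq_true_iff, mem_Pf_iff_prefix ((hsize x s hs).trans (hmono hx))]
  obtain ⟨d, hd⟩ := hW.exists_le_of_completeness hc
    (R := fun e s t => decide (Q ((ν e, s), t))) (ℓ := fun e => f (ν e)) (k := ν)
    (hQ.decide.to_comp.comp (((hν.comp (Computable.fst.comp .fst)).pair
      (Computable.snd.comp .fst)).pair .snd)) (hf.comp hν) fun e => by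
    refine ⟨realPrefix α (f (ν e)), length_realPrefix _ _, ?_, fun t ht q hq hqn => ?_⟩
    · obtain ⟨T, hT⟩ := (stringsUpTo (ν e)).exists_forall_ge
        (P := fun x t => P ((ν e, realPrefix α (f (ν e))), t) x) fun x hx => by
        rw [mem_stringsUpTo] at hx
        by_cases hxW : x ∈ W.Dom
        · obtain ⟨T₁, h₁⟩ := hrun _ x hx true ((hM x).1 hxW)
          obtain ⟨T₂, h₂⟩ := hc.exists_haltsIn hxW
          refine ⟨max T₁ T₂, fun t ht => ?_⟩
          simp only [P]
          rw [h₁ t (le_of_max_le_left ht), h₂ t (le_of_max_le_right ht)]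
        · obtain ⟨T₁, h₁⟩ := hrun _ x hx false ((hM x).2 hxW)
          refine ⟨T₁, fun t ht => ?_⟩
          simp only [P]
          rw [h₁ t ht, Bool.eq_false_iff.2 fun h => hxW (hc.mem_dom_of_haltsIn h)]
      exact ⟨T, decide_eq_true (hT T le_rfl)⟩
    · have h₁ := of_decide_eq_true ht q (mem_stringsUpTo.2 hqn)
      obtain ⟨T, h₂⟩ := hrun _ q hqn true ((hM q).1 hq)
      exact OracleTM.run_unique h₁ (h₂ T le_rfl)
  have h₁ := hd (d + 1)
  have h₂ := hνlt (d + 1)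
  omega

/-! ### Kraft's inequality and halting probabilities -/

theorem PrefixFree.uniquelyDecodable {D : Set (List Bool)} (hD : PrefixFree D) (hnil : [] ∉ D) :
    InformationTheory.UniquelyDecodable D := by
  intro L₁
  induction L₁ with
  | nil =>
    rintro (_ | ⟨w, L₂⟩) _ h₂ h
    · rfl
    · have : w = [] := by
        have := h.symm
        simp only [List.flatten_nil, List.flatten_cons, List.append_eq_nil_iff] at this
        exact this.1
      exact absurd (this ▸ h₂ w (by simp)) hnil
  | cons v L₁ ih =>
    rintro (_ | ⟨w, L₂⟩) h₁ h₂ h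
    · have : v = [] := by
        simp only [List.flatten_nil, List.flatten_cons, List.append_eq_nil_iff] at h
        exact h.1
      exact absurd (this ▸ h₁ v (by simp)) hnil
    · have hv := h₁ v (by simp)
      have hw := h₂ w (by simp)
      simp only [List.flatten_cons] at h
      obtain rfl : v = w := by
        rcases List.prefix_or_prefix_of_prefix (List.prefix_append v L₁.flatten)
          (h ▸ List.prefix_append w L₂.flatten) with hvw | hvw
        · exact hD v hv w hw hvw
        · exact (hD w hw v hv hvw).symm
      rw [ih L₂ (fun u hu => h₁ u (by simp [hu])) (fun u hu => h₂ u (by simp [hu]))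
        (List.append_cancel_left h)]

theorem PrefixFree.sum_le_one {D : Set (List Bool)} (hD : PrefixFree D) {S : Finset (List Bool)}
    (hS : ∀ p ∈ S, p ∈ D) : ∑ p ∈ S, (2 : ℝ)⁻¹ ^ p.length ≤ 1 := by
  -- Unique decodability fails for a code containing the empty word; in that case prefix-freeness
  -- leaves no other word.
  by_cases hnil : [] ∈ S
  · have : S = {[]} := Finset.eq_singleton_iff_unique_mem.2 ⟨hnil, fun p hp =>
      (hD _ (hS _ hnil) _ (hS p hp) List.nil_prefix).symm⟩
    simp [this]
  · have hS' : PrefixFree (S : Set (List Bool)) := fun p hp q hq => hD p (hS p hp) q (hS q hq)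
    simpa using InformationTheory.kraft_mcmillan_inequality (hS'.uniquelyDecodable hnil)

theorem PrefixFree.summable {D : Set (List Bool)} (hD : PrefixFree D) :
    Summable fun p : D => (2 : ℝ)⁻¹ ^ (p : List Bool).length := by
  refine summable_of_sum_le (fun _ => by positivity) (c := 1) fun u => ?_
  have := hD.sum_le_one (S := u.map (Function.Embedding.subtype _)) (by simp +contextual)
  simpa using this

theorem sum_le_haltingProb {V : List Bool →. List Bool} (hV : PrefixFree V.Dom)
    {S : Finset (List Bool)} (hS : ∀ p ∈ S, p ∈ V.Dom) :
    ∑ p ∈ S, (2 : ℝ)⁻¹ ^ p.length ≤ haltingProb V := by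
  classical
  have := hV.summable.sum_le_tsum (S.subtype (· ∈ V.Dom)) fun _ _ => by positivity
  rwa [Finset.sum_subtype_of_mem (fun p : List Bool => (2 : ℝ)⁻¹ ^ p.length) hS] at this

theorem exists_lt_sum_of_lt_haltingProb {V : List Bool →. List Bool} (hV : PrefixFree V.Dom)
    {r : ℝ} (hr : r < haltingProb V) :
    ∃ S : Finset (List Bool), (∀ p ∈ S, p ∈ V.Dom) ∧ r < ∑ p ∈ S, (2 : ℝ)⁻¹ ^ p.length := by
  obtain ⟨u, hu⟩ := (hV.summable.hasSum.eventually_const_lt hr).exists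
  exact ⟨u.map (Function.Embedding.subtype _), by simp +contextual, by simpa using hu⟩

/-- Otherwise `∑ 2⁻¹ ^ m` over `C m` is at least `2⁻¹ ^ (K + c)` for `2 ^ (K + c + 1) + 1`
consecutive values of `m`, more than `2` in total. Summed over `m` first, each `p` contributes at
most `2 * 2⁻¹ ^ |p|`, so Kraft's inequality bounds the total by `2`. -/
theorem PrefixFree.exists_card_small {D : Set (List Bool)} (hD : PrefixFree D)
    {C : ℕ → Finset (List Bool)} (hC : ∀ m p, p ∈ C m ↔ p ∈ D ∧ p.length ≤ m) (K c : ℕ) :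
    ∃ n ≤ K + 2 ^ (K + c + 1), 2 ^ K * ((C (n + c)).card + 1) ≤ 2 ^ n := by
  by_contra! h
  set J := 2 ^ (K + c + 1)
  set S := C (K + J + c)
  have hlow : ∀ m ∈ Finset.Ico (K + c) (K + c + (J + 1)),
      (2 : ℝ)⁻¹ ^ (K + c) ≤ ∑ p ∈ S with p.length ≤ m, (2 : ℝ)⁻¹ ^ m := by
    intro m hm
    rw [Finset.mem_Ico] at hm
    obtain ⟨j, rfl⟩ := Nat.exists_eq_add_of_le hm.1
    have hSm : {p ∈ S | p.length ≤ K + c + j} = C (K + j + c) := by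
      ext p
      simp only [S, Finset.mem_filter, hC]
      constructor
      · rintro ⟨⟨h₁, -⟩, h₂⟩; exact ⟨h₁, by omega⟩
      · rintro ⟨h₁, h₂⟩; exact ⟨⟨h₁, by omega⟩, by omega⟩
    have hj := h (K + j) (by omega)
    rw [pow_add] at hj
    have hj' : 2 ^ j ≤ (C (K + j + c)).card :=
      Nat.lt_succ_iff.1 (Nat.lt_of_mul_lt_mul_left hj)
    rw [hSm, Finset.sum_const, nsmul_eq_mul, pow_add _ (K + c) j]
    have hj'' : (2 : ℝ) ^ j ≤ (C (K + j + c)).card := by exact_mod_cast hj'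
    calc (2 : ℝ)⁻¹ ^ (K + c) = 2 ^ j * ((2 : ℝ)⁻¹ ^ (K + c) * 2⁻¹ ^ j) := by
          rw [mul_left_comm, ← mul_pow]; simp
      _ ≤ _ := by gcongr
  have hsum := Finset.card_nsmul_le_sum _ _ _ hlow
  simp only [Finset.sum_filter] at hsum
  rw [Finset.sum_comm] at hsum
  have hup : ∀ p ∈ S, ∑ m ∈ Finset.Ico (K + c) (K + c + (J + 1)),
      (if p.length ≤ m then (2 : ℝ)⁻¹ ^ m else 0) ≤ 2 * 2⁻¹ ^ p.length := by
    intro p _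
    rw [← Finset.sum_filter]
    calc _ ≤ ∑ m ∈ Finset.Ico p.length (K + c + (J + 1)), (2 : ℝ)⁻¹ ^ m := by
          refine Finset.sum_le_sum_of_subset_of_nonneg (fun m hm => ?_) fun _ _ _ => by positivity
          simp only [Finset.mem_filter, Finset.mem_Ico] at hm ⊢
          exact ⟨hm.2, hm.1.2⟩
      _ ≤ (2 : ℝ)⁻¹ ^ p.length / (1 - 2⁻¹) :=
          geom_sum_Ico_le_of_lt_one (by norm_num) (by norm_num)
      _ = _ := by ring
  have h₁ := hsum.trans (Finset.sum_le_sum hup)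
  rw [← Finset.mul_sum] at h₁
  have h₂ := hD.sum_le_one (S := S) fun p hp => ((hC _ p).1 hp).1
  have h₃ : ((J + 1 : ℕ) : ℝ) * 2⁻¹ ^ (K + c) = 2 + 2⁻¹ ^ (K + c) := by
    simp only [J]
    push_cast
    rw [add_mul, pow_succ, mul_right_comm, ← mul_pow]
    simp
  have h₄ : (0 : ℝ) < 2⁻¹ ^ (K + c) := by positivity
  simp only [Nat.card_Ico, Nat.add_sub_cancel_left, nsmul_eq_mul] at h₁
  rw [h₃] at h₁
  linarith

/-! ### Binary numerals -/

/-- The number with the binary numeral `s`. -/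
def strVal (s : List Bool) : ℕ :=
  s.foldl (fun n b => 2 * n + cond b 1 0) 0

theorem strVal_concat (s : List Bool) (b : Bool) :
    strVal (s ++ [b]) = 2 * strVal s + cond b 1 0 := by
  simp [strVal]

theorem exists_strVal_eq {n v : ℕ} (h : v < 2 ^ n) :
    ∃ s : List Bool, s.length = n ∧ strVal s = v := by
  induction n generalizing v with
  | zero => exact ⟨[], rfl, by simp [strVal]; omega⟩
  | succ n ih =>
    obtain ⟨s, hs, hv⟩ := ih (v := v / 2) (by omega)
    refine ⟨s ++ [decide (v % 2 = 1)], by simp [hs], ?_⟩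
    rw [strVal_concat, hv]
    rcases Nat.mod_two_eq_zero_or_one v with h | h <;> simp [h] <;> omega

theorem primrec_strVal : Primrec strVal := by
  refine Primrec.list_foldl (h := fun _ p => 2 * p.1 + cond p.2 1 0) .id (.const 0) ?_
  exact Primrec.nat_add.comp (Primrec.nat_double.comp (Primrec.fst.comp .snd))
    (Primrec.cond (Primrec.snd.comp .snd) (.const 1) (.const 0))

theorem realPrefix_succ (α : ℝ) (n : ℕ) : realPrefix α (n + 1) =
    realPrefix α n ++ [decide (Real.digits (Int.fract α) 2 n = 1)] := by
  rw [realPrefix, List.ofFn_succ', List.concat_eq_append]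
  rfl

theorem strVal_realPrefix (α : ℝ) (n : ℕ) :
    strVal (realPrefix α n) = ⌊Int.fract α * 2 ^ n⌋₊ := by
  induction n with
  | zero =>
    have : ⌊Int.fract α⌋₊ = 0 := Nat.floor_eq_zero.2 (Int.fract_lt_one α)
    simp [realPrefix, strVal, this]
  | succ n ih =>
    have hdiv : ⌊Int.fract α * 2 ^ n⌋₊ = ⌊Int.fract α * 2 ^ (n + 1)⌋₊ / 2 := by
      rw [← Nat.floor_div_ofNat, pow_succ]
      congr 1
      ring
    rw [realPrefix_succ, strVal_concat, ih, hdiv]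
    have hdig : Real.digits (Int.fract α) 2 n = 1 ↔ ⌊Int.fract α * 2 ^ (n + 1)⌋₊ % 2 = 1 := by
      rw [Fin.ext_iff]
      simp [Real.digits]
    rcases Nat.mod_two_eq_zero_or_one ⌊Int.fract α * 2 ^ (n + 1)⌋₊ with h | h <;>
      simp [hdig, h] <;> omega

theorem strVal_realPrefix_le {α : ℝ} (hα : 0 ≤ α) (n : ℕ) :
    ((⌊α⌋₊ * 2 ^ n + strVal (realPrefix α n) : ℕ) : ℝ) ≤ α * 2 ^ n := by
  have h := Nat.floor_le (a := Int.fract α * 2 ^ n)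
    (mul_nonneg (Int.fract_nonneg α) (by positivity))
  rw [strVal_realPrefix]
  push_cast
  have hfl : ((⌊α⌋₊ : ℕ) : ℝ) = ((⌊α⌋ : ℤ) : ℝ) := natCast_floor_eq_intCast_floor hα
  rw [hfl]
  conv_rhs => rw [← Int.floor_add_fract α]
  linarith [add_mul (⌊α⌋ : ℝ) (Int.fract α) (2 ^ n)]

theorem lt_strVal_realPrefix {α : ℝ} (hα : 0 ≤ α) (n : ℕ) :
    α * 2 ^ n < ((⌊α⌋₊ * 2 ^ n + strVal (realPrefix α n) : ℕ) : ℝ) + 1 := by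
  have h := Nat.lt_floor_add_one (Int.fract α * 2 ^ n)
  rw [strVal_realPrefix]
  push_cast
  have hfl : ((⌊α⌋₊ : ℕ) : ℝ) = ((⌊α⌋ : ℤ) : ℝ) := natCast_floor_eq_intCast_floor hα
  rw [hfl]
  conv_lhs => rw [← Int.floor_add_fract α]
  linarith [add_mul (⌊α⌋ : ℝ) (Int.fract α) (2 ^ n)]

/-! ### Approximating the halting probability -/

theorem length_stringsOfLength (n : ℕ) : (stringsOfLength n).length = 2 ^ n := by
  induction n with
  | zero => rfl
  | succ n ih => simp [stringsOfLength, ih, pow_succ, mul_two]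

theorem nodup_stringsUpTo (n : ℕ) : (stringsUpTo n).Nodup := by
  refine List.nodup_flatMap.2 ⟨fun _ _ => nodup_stringsOfLength _, ?_⟩
  refine List.Nodup.pairwise_of_forall_ne List.nodup_range fun i _ j _ hij s hi hj => hij ?_
  rw [← mem_stringsOfLength.1 hi, mem_stringsOfLength.1 hj]

/-- The programs of length at most `n` that halt within stage `t`. -/
def haltedUpTo (c : Code) (n t : ℕ) : Finset (List Bool) :=
  {p ∈ (stringsUpTo n).toFinset | haltsIn c t p}

theorem mem_haltedUpTo {c : Code} {n t : ℕ} {p : List Bool} :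
    p ∈ haltedUpTo c n t ↔ p.length ≤ n ∧ haltsIn c t p := by
  simp [haltedUpTo, mem_stringsUpTo]

/-- `2 ^ t` times the approximation of the halting probability at stage `t`. -/
def stageSum (c : Code) (t : ℕ) : ℕ :=
  ((stringsUpTo t).map fun p => bif haltsIn c t p then 2 ^ (t - p.length) else 0).sum

theorem stageSum_eq (c : Code) (t : ℕ) :
    (stageSum c t : ℝ) = 2 ^ t * ∑ p ∈ haltedUpTo c t t, (2 : ℝ)⁻¹ ^ p.length := by
  rw [stageSum, ← List.sum_toFinset _ (nodup_stringsUpTo t), haltedUpTo, Finset.sum_filter,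
    Finset.mul_sum, Nat.cast_sum]
  refine Finset.sum_congr rfl fun p hp => ?_
  rw [List.mem_toFinset, mem_stringsUpTo] at hp
  cases haltsIn c t p
  · simp
  · simp only [cond_true, if_true]
    push_cast
    rw [inv_pow, pow_sub₀ _ two_ne_zero hp]

theorem primrec_pow : Primrec₂ fun m n : ℕ => m ^ n :=
  Primrec₂.unpaired'.1 Nat.Primrec.pow

theorem primrec_stageSum (c : Code) : Primrec (stageSum c) := by
  have hterm : Primrec₂ fun (t : ℕ) (p : List Bool) =>
      bif haltsIn c t p then 2 ^ (t - p.length) else 0 :=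
    Primrec.cond ((primrec_haltsIn c).comp .fst .snd) (primrec_pow.comp (.const 2)
      (Primrec.nat_sub.comp .fst (Primrec.list_length.comp .snd))) (.const 0)
  refine (Primrec.list_foldr (f := fun t => (stringsUpTo t).map fun p =>
    bif haltsIn c t p then 2 ^ (t - p.length) else 0) (g := fun _ => 0)
    (h := fun _ p => p.1 + p.2) (Primrec.list_map primrec_stringsUpTo hterm) (.const 0)
    (Primrec.nat_add.comp (Primrec.fst.comp .snd) (Primrec.snd.comp .snd)).to₂).of_eq fun t => ?_
  rw [stageSum, List.sum_eq_foldr]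

theorem haltingProb_nonneg (V : List Bool →. List Bool) : 0 ≤ haltingProb V :=
  tsum_nonneg fun _ => by positivity

section

variable {V : List Bool →. List Bool} {c : Code}

/-- Divided by `2 ^ (N + t)`, the inequality says that the truncation of `Ω` to `N` bits is below
the stage `t` approximation plus `2 ^ (-N)`. The slack is needed because the approximations may
never reach the truncation. Keeping the integer part avoids excluding `Ω = 1`. -/
theorem exists_forall_lt_stageSum (hV : PrefixFree V.Dom) (hc : IsCodeOf c V) (N : ℕ) :
    ∃ T, ∀ t ≥ T,
      (⌊haltingProb V⌋₊ * 2 ^ N + strVal (realPrefix (haltingProb V) N)) * 2 ^ t <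
        stageSum c t * 2 ^ N + 2 ^ t := by
  obtain ⟨S, hS, hlt⟩ := exists_lt_sum_of_lt_haltingProb hV
    (r := haltingProb V - (2 ^ N)⁻¹) (by simp)
  obtain ⟨T, hT⟩ := S.toList.exists_forall_ge (P := fun p t => p ∈ haltedUpTo c t t) fun p hp => by
    obtain ⟨T, hT⟩ := hc.exists_haltsIn (hS p (Finset.mem_toList.1 hp))
    exact ⟨max p.length T, fun t ht =>
      mem_haltedUpTo.2 ⟨le_of_max_le_left ht, hT t (le_of_max_le_right ht)⟩⟩
  refine ⟨T, fun t ht => ?_⟩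
  have hsub : S ⊆ haltedUpTo c t t := fun p hp => hT t ht p (Finset.mem_toList.2 hp)
  have h₁ := Finset.sum_le_sum_of_subset_of_nonneg (f := fun p => (2 : ℝ)⁻¹ ^ p.length) hsub
    fun _ _ _ => by positivity
  have h₂ := strVal_realPrefix_le (haltingProb_nonneg V) N
  have h₃ : haltingProb V * 2 ^ N <
      (∑ p ∈ haltedUpTo c t t, (2 : ℝ)⁻¹ ^ p.length) * 2 ^ N + 1 := by
    have := mul_lt_mul_of_pos_right (hlt.trans_le h₁) (show (0 : ℝ) < 2 ^ N by positivity)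
    rw [sub_mul, inv_mul_cancel₀ (by positivity)] at this
    linarith
  have h₄ := mul_lt_mul_of_pos_right (h₂.trans_lt h₃) (show (0 : ℝ) < 2 ^ t by positivity)
  rw [← Nat.cast_lt (α := ℝ)]
  push_cast at h₄ ⊢
  rw [stageSum_eq]
  linarith

/-- The truncation error and the slack leave less than `2 * 2 ^ (-N)` of `Ω` missing at stage `t`,
while a program shorter than `N` would still add at least that much. -/
theorem haltsIn_of_lt_stageSum (hV : PrefixFree V.Dom) (hc : IsCodeOf c V) {N t : ℕ}
    (h : (⌊haltingProb V⌋₊ * 2 ^ N + strVal (realPrefix (haltingProb V) N)) * 2 ^ t <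
        stageSum c t * 2 ^ N + 2 ^ t) {q : List Bool} (hq : q ∈ V.Dom) (hqN : q.length + 1 ≤ N) :
    haltsIn c t q := by
  by_contra hnot
  have hmem : q ∉ haltedUpTo c t t := fun h => hnot (mem_haltedUpTo.1 h).2
  have h₁ := sum_le_haltingProb hV (S := insert q (haltedUpTo c t t)) fun p hp => by
    rcases Finset.mem_insert.1 hp with rfl | hp
    · exact hq
    · exact hc.mem_dom_of_haltsIn (mem_haltedUpTo.1 hp).2
  rw [Finset.sum_insert hmem] at h₁
  have h₂ := lt_strVal_realPrefix (haltingProb_nonneg V) N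
  rw [← Nat.cast_lt (α := ℝ)] at h
  generalize ⌊haltingProb V⌋₊ * 2 ^ N + strVal (realPrefix (haltingProb V) N) = v at h h₂
  push_cast at h
  rw [stageSum_eq] at h
  set x := ∑ p ∈ haltedUpTo c t t, (2 : ℝ)⁻¹ ^ p.length
  have h₃ : (v : ℝ) < x * 2 ^ N + 1 := by
    refine lt_of_mul_lt_mul_right ?_ (show (0 : ℝ) ≤ 2 ^ t by positivity)
    linarith
  have h₄ : (2 : ℝ) ≤ 2⁻¹ ^ q.length * 2 ^ N := by
    obtain ⟨j, rfl⟩ := Nat.exists_eq_add_of_le hqN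
    have : (2 : ℝ)⁻¹ ^ q.length * 2 ^ (q.length + 1 + j) = 2 * 2 ^ j := by
      rw [pow_add, pow_succ, ← mul_assoc, ← mul_assoc, ← mul_pow]
      simp
    rw [this]
    linarith [one_le_pow₀ (M₀ := ℝ) one_le_two (n := j)]
  have h₅ := mul_le_mul_of_nonneg_right h₁ (show (0 : ℝ) ≤ 2 ^ N by positivity)
  rw [add_mul] at h₅
  linarith

end

/-! ### Reducing the halting probability to the halting problem -/

/-- The programs of length at most `σ.2` that halt within stage `σ.1`, as an oracle. -/
def stageOracle (c : Code) (σ : ℕ × ℕ) (q : List Bool) : Bool :=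
  decide (q.length ≤ σ.2) && haltsIn c σ.1 q

theorem primrec_stageOracle (c : Code) : Primrec₂ (stageOracle c) :=
  Primrec.and.comp (Primrec.nat_le.decide.comp (Primrec.list_length.comp .snd)
    (Primrec.snd.comp .fst)) ((primrec_haltsIn c).comp (Primrec.fst.comp .fst) .snd)

/-- With the oracle of stage `t`, restricted to queries that exceed the input by at most `e` in
length, `M` decides within `t` steps the set of prefixes of `u` up to length `N`. -/
def DecidesPrefixes (M : OracleTM) (c : Code) (e N t : ℕ) (u : List Bool) : Prop :=
  ∀ v ∈ stringsUpTo N,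
    M.run (stageOracle c (t, v.length + e)) v t = some (decide (v <+: u))

/-- The halted sets grow with the stage, so their cardinality determines them. -/
theorem haltedUpTo_eq_of_card_eq {c : Code} {n t t' : ℕ}
    (h : (haltedUpTo c n t).card = (haltedUpTo c n t').card) :
    haltedUpTo c n t = haltedUpTo c n t' := by
  have hmono {t t' : ℕ} (htt' : t ≤ t') : haltedUpTo c n t ⊆ haltedUpTo c n t' := fun p hp => by
    rw [mem_haltedUpTo] at hp ⊢
    exact ⟨hp.1, haltsIn_mono htt' hp.2⟩
  rcases le_total t t' with htt' | htt'
  · exact Finset.eq_of_subset_of_card_le (hmono htt') h.ge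
  · exact (Finset.eq_of_subset_of_card_le (hmono htt') h.le).symm

/-- On input `u.take n` the oracle is cut off at length `n + e`, so both stages give the same run
and the same answer. -/
theorem DecidesPrefixes.take_eq {M : OracleTM} {c : Code} {e N n t t' : ℕ} {u u' : List Bool}
    (hu : DecidesPrefixes M c e N t u) (hu' : DecidesPrefixes M c e N t' u') (hn : n ≤ N)
    (hlen : n ≤ u.length) (h : haltedUpTo c (n + e) t = haltedUpTo c (n + e) t') :
    u.take n = u'.take n := by
  have hl : (u.take n).length = n := by simp [hlen]
  have hmem : u.take n ∈ stringsUpTo N := mem_stringsUpTo.2 (hl.trans_le hn)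
  have h₁ := hu _ hmem
  have h₂ := hu' _ hmem
  have hO : stageOracle c (t, (u.take n).length + e) =
      stageOracle c (t', (u.take n).length + e) := by
    funext q
    rw [hl]
    have := congrArg (q ∈ ·) h
    simp only [mem_haltedUpTo, eq_iff_iff] at this
    rw [Bool.eq_iff_iff]
    simpa [stageOracle] using this
  rw [hO] at h₁
  have := OracleTM.run_unique h₁ h₂
  rw [decide_eq_true (List.take_prefix n u)] at this
  have := List.prefix_iff_eq_take.1 (of_decide_eq_true this.symm)
  rwa [hl] at this

/-- Each `u` is recovered from its last `N - n` bits and the number of programs of length at most `n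
+ e` halted at its stage, a number between `0` and `C.card`. -/
theorem card_le_of_decidesPrefixes {W : List Bool →. List Bool} {c : Code} (hc : IsCodeOf c W)
    {M : OracleTM} {e N n : ℕ} (hn : n ≤ N) {C G : Finset (List Bool)}
    (hC : ∀ p, p ∈ C ↔ p ∈ W.Dom ∧ p.length ≤ n + e)
    (hG : ∀ u ∈ G, u.length = N ∧ ∃ t, DecidesPrefixes M c e N t u) :
    G.card ≤ 2 ^ (N - n) * (C.card + 1) := by
  choose! hlen τ hτ using hG
  have hcard := Finset.card_le_card_of_injOn (s := G)
    (t := (stringsOfLength (N - n)).toFinset ×ˢ Finset.range (C.card + 1))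
    (fun u => (u.drop n, (haltedUpTo c (n + e) (τ u)).card)) ?_ ?_
  · rwa [Finset.card_product, List.toFinset_card_of_nodup (nodup_stringsOfLength _),
      length_stringsOfLength, Finset.card_range] at hcard
  · intro u hu
    simp only [Finset.coe_product, Set.mem_prod, Finset.mem_coe, List.mem_toFinset,
      mem_stringsOfLength, Finset.mem_range, Nat.lt_succ_iff, List.length_drop]
    refine ⟨by rw [hlen u hu], Finset.card_le_card fun p hp => ?_⟩
    rw [mem_haltedUpTo] at hp
    exact (hC p).2 ⟨hc.mem_dom_of_haltsIn hp.2, hp.1⟩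
  · intro u hu u' hu' h
    simp only [Prod.mk.injEq] at h
    rw [← List.take_append_drop n u, ← List.take_append_drop n u', h.1,
      (hτ u hu).take_eq (hτ u' hu') hn (by rw [hlen u hu]; exact hn)
        (haltedUpTo_eq_of_card_eq h.2)]

theorem not_Pf_haltingProb_reducible {V W : List Bool →. List Bool}
    (hV : IsOptimalPrefixFreeMachine V) (hW : IsPrefixFreeMachine W) {g : ℕ → ℕ} {e : ℕ}
    (hg : ∀ n, g n ≤ n + e) : ¬ ReducibleInQuerySize (Pf (haltingProb V)) W.Dom g := by
  classical
  rintro ⟨M, hM, hsize⟩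
  obtain ⟨cV, hcV⟩ := Partrec.exists_isCodeOf hV.1.1
  obtain ⟨cW, hcW⟩ := Partrec.exists_isCodeOf hW.1
  set Ω := haltingProb V
  -- Stage `t` makes `x.2` a candidate: it does not exceed the current approximation of `Ω` by too
  -- much, and the simulated reduction confirms it.
  let good (t : ℕ) (x : ℕ × List Bool) : Prop :=
    (⌊Ω⌋₊ * 2 ^ x.1 + strVal x.2) * 2 ^ t < stageSum cV t * 2 ^ x.1 + 2 ^ t ∧
      DecidesPrefixes M cW e x.1 t x.2
  have hgood : PrimrecRel good := by
    have ht : Primrec fun y : ℕ × ℕ × List Bool => y.1 := .fst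
    have hN : Primrec fun y : ℕ × ℕ × List Bool => y.2.1 := Primrec.fst.comp .snd
    have hu : Primrec fun y : ℕ × ℕ × List Bool => y.2.2 := Primrec.snd.comp .snd
    have h2t := primrec_pow.comp (.const 2) ht
    have h2N := primrec_pow.comp (.const 2) hN
    have h₁ : PrimrecPred fun y : ℕ × ℕ × List Bool =>
        (⌊Ω⌋₊ * 2 ^ y.2.1 + strVal y.2.2) * 2 ^ y.1 < stageSum cV y.1 * 2 ^ y.2.1 + 2 ^ y.1 :=
      Primrec.nat_lt.comp
        (Primrec.nat_mul.comp (Primrec.nat_add.comp (Primrec.nat_mul.comp (.const _) h2N)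
          (primrec_strVal.comp hu)) h2t)
        (Primrec.nat_add.comp (Primrec.nat_mul.comp ((primrec_stageSum cV).comp ht) h2N) h2t)
    have h₂ : PrimrecRel fun (v : List Bool) (y : ℕ × ℕ × List Bool) =>
        M.run (stageOracle cW (y.1, v.length + e)) v y.1 = some (decide (v <+: y.2.2)) :=
      Primrec.eq.comp (M.primrec_run (primrec_stageOracle cW)
        ((ht.comp .snd).pair (Primrec.nat_add.comp (Primrec.list_length.comp .fst) (.const e)))
        .fst (ht.comp .snd))
        (Primrec.option_some.comp (primrecPred_prefix.decide.comp .fst (hu.comp .snd)))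
    exact h₁.and (h₂.forall_mem_list.comp (primrec_stringsUpTo.comp hN) .id)
  let found (u : List Bool) (x : ℕ × ℕ) : Prop := ∃ t ∈ List.range x.2, good t (x.1, u)
  have hfound : PrimrecRel found :=
    PrimrecRel.comp (R := fun L x => ∃ t ∈ L, good t x) hgood.exists_mem_list
      (f := fun y : List Bool × ℕ × ℕ => List.range y.2.2) (g := fun y => (y.2.1, y.1))
      (Primrec.list_range.comp (Primrec.snd.comp .snd)) ((Primrec.fst.comp .snd).pair .fst)
  -- `F N t` enumerates, increasingly in `t`, the set `G N` of all candidates.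
  let F (N t : ℕ) : List (List Bool) := (stringsOfLength N).filter fun u => found u (N, t)
  have hF : Primrec₂ F :=
    hfound.listFilter.comp (primrec_stringsOfLength.comp .fst) .id
  have hFnodup (N t : ℕ) : (F N t).Nodup := (nodup_stringsOfLength N).filter _
  let G (N : ℕ) : Finset (List Bool) :=
    {u ∈ (stringsOfLength N).toFinset | ∃ t, good t (N, u)}
  have hFG (N t : ℕ) : (F N t).toFinset ⊆ G N := by
    intro u hu
    simp only [F, G, found, List.mem_toFinset, List.mem_filter, Finset.mem_filter,
      decide_eq_true_iff] at hu ⊢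
    exact ⟨hu.1, hu.2.imp fun t ht => ht.2⟩
  have hFG' (N : ℕ) : ∃ t, G N ⊆ (F N t).toFinset := by
    obtain ⟨T, hT⟩ := (G N).toList.exists_forall_ge (P := fun u t => u ∈ F N t) fun u hu => by
      simp only [G, Finset.mem_toList, Finset.mem_filter, List.mem_toFinset] at hu
      obtain ⟨t, ht⟩ := hu.2
      refine ⟨t + 1, fun t' ht' => List.mem_filter.2 ⟨hu.1, decide_eq_true ⟨t, List.mem_range.2 (by omega), ht⟩⟩⟩
    exact ⟨T, fun u hu => List.mem_toFinset.2 (hT T le_rfl u (Finset.mem_toList.2 hu))⟩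
  have hΩG (N : ℕ) : realPrefix Ω N ∈ G N := by
    simp only [G, Finset.mem_filter, List.mem_toFinset, mem_stringsOfLength, length_realPrefix,
      true_and]
    obtain ⟨T₁, h₁⟩ := exists_forall_lt_stageSum hV.1.2 hcV N
    -- From `T₂` on, the oracle is final on every string that the cutoff admits.
    obtain ⟨T₂, h₂⟩ := (stringsUpTo (N + e)).exists_forall_ge
      (P := fun q t => haltsIn cW t q = true ↔ q ∈ W.Dom) fun q _ => by
      by_cases hq : q ∈ W.Dom
      · obtain ⟨T, hT⟩ := hcW.exists_haltsIn hq
        exact ⟨T, fun t ht => by simp [hT t ht, hq]⟩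
      · exact ⟨0, fun t _ => ⟨hcW.mem_dom_of_haltsIn, fun h => absurd h hq⟩⟩
    obtain ⟨T₃, h₃⟩ := (stringsUpTo N).exists_forall_ge (P := fun v t =>
        M.run (stageOracle cW (t, v.length + e)) v t = some (decide (v <+: realPrefix Ω N)))
        fun v hv => by
      rw [mem_stringsUpTo] at hv
      have hans : M.Answers W.Dom v (decide (v <+: realPrefix Ω N)) := by
        by_cases h : v <+: realPrefix Ω N
        · rw [decide_eq_true h]
          exact (hM v).1 ((mem_Pf_iff_prefix hv).2 h)
        · rw [decide_eq_false h]
          exact (hM v).2 fun h' => h ((mem_Pf_iff_prefix hv).1 h')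
      have hO (t : ℕ) (ht : T₂ ≤ t) : stageOracle cW (t, v.length + e) =
          stageOracle cW (T₂, v.length + e) := by
        funext q
        rw [Bool.eq_iff_iff]
        simp only [stageOracle, Bool.and_eq_true, decide_eq_true_iff]
        refine and_congr_right fun hq => ?_
        have hmem : q ∈ stringsUpTo (N + e) := mem_stringsUpTo.2 (by omega)
        rw [h₂ t ht q hmem, h₂ T₂ le_rfl q hmem]
      obtain ⟨T, hT⟩ := OracleTM.eventually_run_eq_some
          (O := stageOracle cW (T₂, v.length + e)) hans fun s hs => by
        have hsl := (hsize v s hs).trans (hg _)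
        simp [stageOracle, hsl, h₂ T₂ le_rfl s (mem_stringsUpTo.2 (by omega))]
      refine ⟨max T T₂, fun t ht => ?_⟩
      rw [hO t (le_of_max_le_right ht), hT t (le_of_max_le_left ht)]
    exact ⟨max T₁ T₃, h₁ _ (le_max_left _ _), h₃ _ (le_max_right _ _)⟩
  let C (m : ℕ) : Finset (List Bool) := {p ∈ (stringsUpTo m).toFinset | p ∈ W.Dom}
  have hC (m : ℕ) (p : List Bool) : p ∈ C m ↔ p ∈ W.Dom ∧ p.length ≤ m := by
    simp [C, mem_stringsUpTo, and_comm]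
  -- With `K = 3 * h`, `N h = K + ℓ h` is exactly the bound on `n` in
  -- `PrefixFree.exists_card_small`.
  let ℓ (h : ℕ) : ℕ := 2 ^ (3 * h + e + 1)
  let N (h : ℕ) : ℕ := 3 * h + ℓ h
  have hGcard (h : ℕ) : (G (N h)).card ≤ 2 ^ ℓ h := by
    obtain ⟨n, hn, hCn⟩ := hW.2.exists_card_small hC (3 * h) e
    have h₁ := card_le_of_decidesPrefixes hcW (M := M) (N := N h) (G := G (N h)) hn (hC _)
      fun u hu => by
        simp only [G, Finset.mem_filter, List.mem_toFinset, mem_stringsOfLength] at hu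
        exact ⟨hu.1, hu.2.imp fun t ht => ht.2⟩
    refine le_of_mul_le_mul_left (a := 2 ^ (3 * h)) ?_ (Nat.two_pow_pos _)
    calc 2 ^ (3 * h) * (G (N h)).card
        ≤ 2 ^ (3 * h) * (2 ^ (N h - n) * ((C (n + e)).card + 1)) := Nat.mul_le_mul_left _ h₁
      _ = 2 ^ (N h - n) * (2 ^ (3 * h) * ((C (n + e)).card + 1)) := by ring
      _ ≤ 2 ^ (N h - n) * 2 ^ n := Nat.mul_le_mul_left _ hCn
      _ = 2 ^ (3 * h) * 2 ^ ℓ h := by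
        rw [← pow_add, ← pow_add, Nat.sub_add_cancel hn]
  have hℓ : Primrec ℓ := primrec_pow.comp (.const 2) (Primrec.succ.comp
    (Primrec.nat_add.comp (Primrec.nat_mul.comp (.const 3) .id) (.const e)))
  have hN : Primrec N := Primrec.nat_add.comp (Primrec.nat_mul.comp (.const 3) .id) hℓ
  have hR : Primrec fun p : (ℕ × List Bool) × ℕ =>
      decide (strVal p.1.2 < (F (N p.1.1) p.2).length) :=
    Primrec.nat_lt.decide.comp (primrec_strVal.comp (Primrec.snd.comp .fst))
      (Primrec.list_length.comp (hF.comp (hN.comp (Primrec.fst.comp .fst)) .snd))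
  obtain ⟨d, hd⟩ := hV.exists_le_of_completeness hcV
    (R := fun h s t => decide (strVal s < (F (N h) t).length)) (ℓ := ℓ) (k := fun h => N h - 1)
    hR.to_comp hℓ.to_comp fun h => by
    have hpos : 0 < (G (N h)).card := Finset.card_pos.2 ⟨_, hΩG _⟩
    -- The certificate encodes the number of candidates minus one, since the number itself may equal
    -- `2 ^ ℓ h` and not fit.
    obtain ⟨s, hs, hval⟩ := exists_strVal_eq (n := ℓ h) (v := (G (N h)).card - 1)
      (by have := hGcard h; omega)
    refine ⟨s, hs, ?_, fun t ht q hq hqN => ?_⟩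
    · obtain ⟨t, ht⟩ := hFG' (N h)
      have := Finset.card_le_card ht
      rw [List.toFinset_card_of_nodup (hFnodup _ _)] at this
      exact ⟨t, decide_eq_true (by omega)⟩
    · have hlt := of_decide_eq_true ht
      rw [← List.toFinset_card_of_nodup (hFnodup _ _), hval] at hlt
      -- All candidates have appeared, the true prefix of `Ω` among them, at some earlier stage
      -- `t'`.
      have heq := Finset.eq_of_subset_of_card_le (hFG (N h) t) (by omega)
      have hmem := heq ▸ hΩG (N h)
      simp only [F, found, List.mem_toFinset, List.mem_filter, decide_eq_true_iff] at hmem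
      obtain ⟨-, t', ht', hgt, -⟩ := hmem
      have hNpos : 0 < ℓ h := Nat.two_pow_pos _
      have hqN' : q.length + 1 ≤ N h := by
        simp only [N] at hqN ⊢
        omega
      exact haltsIn_mono (List.mem_range.1 ht').le (haltsIn_of_lt_stageSum hV.1.2 hcV hgt hq hqN')
  -- The bound reads `3 * h + ℓ h - 1 ≤ ℓ h + h + d`, which fails for `h = d + 1`.
  have h₁ := hd (d + 1)
  simp only [N] at h₁
  omega

/-! ### Unidirectionality from the two bounds. -/

theorem theorem4p3 (V W : List Bool →. List Bool)
    (hV : IsOptimalPrefixFreeMachine V) (hW : IsOptimalPrefixFreeMachine W) :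
    IsUnidirectional (Pf (haltingProb V)) W.Dom ∧
      IsUnidirectional W.Dom (Pf (haltingProb V)) := by
  constructor
  · rintro f g hf hg hfred hgred ⟨B, hB⟩
    obtain ⟨c, hc⟩ := exists_le_add_of_dom_reducible_Pf hW hf.1 hf.2.1 hfred
    refine not_Pf_haltingProb_reducible hV hW.1 (e := c + B.toNat) (fun n => ?_) hgred
    -- Since `n ≤ f (n + c)`, monotonicity gives `g n ≤ g (f (n + c)) ≤ n + c + B`.
    have h₁ := hB ⟨n + c, rfl⟩
    have h₂ : g n ≤ g (f (n + c)) := hg.1 (by have := hc (n + c); omega)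
    simp only at h₁
    omega
  · rintro f g hf hg hfred hgred ⟨B, hB⟩
    obtain ⟨c, hc⟩ := exists_le_add_of_dom_reducible_Pf hW hg.1 hg.2.1 hgred
    -- Here the bound (A) applies to `g`, at the argument `f n`: `f n ≤ g (f n) + c ≤ n + B + c`.
    refine not_Pf_haltingProb_reducible hV hW.1 (e := c + B.toNat) (fun n => ?_) hfred
    have h₁ := hB ⟨n, rfl⟩
    have h₂ := hc (f n)
    simp only at h₁
    omega
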